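/- Consider $p$-objective optimization problems in which every instance $I$ consists of a set $X$ of feasible solutions and objective functions $f_1,\dots,f_p:X\to\mathbb{Q}_{>0}$. For $\alpha\in[1,\infty)^p$, a solution $x$ $\alpha$-approximates $x'$ if $f_i(x)\le\alpha_i f_i(x')$ for all $i$ (for maximization: $f_i(x')\le\alpha_i f_i(x)$ for all $i$). For $\varepsilon>0$, a set $P\subseteq X$ is a quasi-$k$-exact $(1+\varepsilon)$-approximation set if every $x'\in X$ is $\alpha$-approximated by some $x\in P$ for some $\alpha$ (depending on $x'$) with $k$ components equal to $1$ and the other $p-k$ components equal to $1+\varepsilon$. For every fixed $p$, each of the following $p$-objective problems (with positive rational data encoded in binary) has instances that admit no polynomial-cardinality quasi-$k$-exact $(1+\varepsilon)$-approximation set for any $k>\lceil p/2\rceil$ and any $\varepsilon>0$: shortest $s$-$t$-path in directed graphs; minimum spanning tree; assignment; minimum $s$-$t$-cut in directed graphs; knapsack (maximize $p$ profits over nonempty item sets respecting one capacity); and symmetric traveling salesman. Precisely, for each of these problems there is a sequence $(I_n)_{n\in\mathbb{N}}$ of instances with positive objective values such that for every polynomial $Q$ with nonnegative integer coefficients there is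 $n_0$ such that for all $n\ge n_0$, all $k>\lceil p/2\rceil$ and all $\varepsilon>0$, every quasi-$k$-exact $(1+\varepsilon)$-approximation set $P$ of $I_n$ satisfies $|P|>Q(\mathrm{enc}(I_n))$, where $\mathrm{enc}(I_n)$ is the encoding length of $I_n$. -/

import Mathlib

/-- Whether the objective functions are to be minimized or maximized. -/
inductive Sense where
  | minimize
  | maximize

/-- A `p`-objective optimization problem: a set of instances, each with an encoding length, a set of
feasible solutions (here: a type) and `p` rational-valued objective functions. -/
structure MOProblem (p : ℕ) where
  /-- the instances -/
  Instance : Type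
  /-- the encoding length of an instance -/
  encLen : Instance → ℕ
  /-- the set of feasible solutions of an instance -/
  Solution : Instance → Type
  /-- the vector of objective functions of an instance -/
  objective : (I : Instance) → Solution I → Fin p → ℚ
  /-- minimization or maximization -/
  sense : Sense

namespace MOProblem

variable {p : ℕ} (Pb : MOProblem p) (I : Pb.Instance)

/-- `x` `α`-approximates `x'`: `f_i(x) ≤ α_i · f_i(x')` for all `i` (minimization), respectively
`f_i(x') ≤ α_i · f_i(x)` for all `i` (maximization). -/
def Approximates (α : Fin p → ℝ) (x x' : Pb.Solution I) : Prop :=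
  match Pb.sense with
  | .minimize => ∀ i, (Pb.objective I x i : ℝ) ≤ α i * (Pb.objective I x' i : ℝ)
  | .maximize => ∀ i, (Pb.objective I x' i : ℝ) ≤ α i * (Pb.objective I x i : ℝ)

/-- Quasi-`k`-exact `(1+ε)`-dominance: `x` `α`-approximates `x'` for some `α` with `k` components
equal to `1` and the other `p - k` components equal to `1 + ε`. -/
def QuasiExactDominates (k : ℕ) (ε : ℝ) (x x' : Pb.Solution I) : Prop :=
  ∃ S : Finset (Fin p), S.card = k ∧
    Pb.Approximates I (fun i => if i ∈ S then 1 else 1 + ε) x x'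

/-- `P` is an `R`-approximation set: every feasible solution is `R`-dominated by some element
of `P`. -/
def IsApproximationSet (R : Pb.Solution I → Pb.Solution I → Prop) (P : Set (Pb.Solution I)) : Prop :=
  ∀ x', ∃ x ∈ P, R x x'

/-- Quasi-`k`-exact `(1+ε)`-approximation sets. -/
def IsQuasiExactApproximationSet (k : ℕ) (ε : ℝ) (P : Set (Pb.Solution I)) : Prop :=
  Pb.IsApproximationSet I (Pb.QuasiExactDominates I k ε) P

end MOProblem

/-- Binary encoding length of a (positive) rational number: the bits of its numerator and of its
denominator. -/
def ratEnc (q : ℚ) : ℕ := Nat.size q.num.natAbs + Nat.size q.den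

/-- Encoding length of a vector of `p` rational numbers. -/
def vecEnc {p : ℕ} (c : Fin p → ℚ) : ℕ := ∑ i, ratEnc (c i)

/-- A finite directed graph on the vertices `0, …, n - 1` with two distinct terminals `s`, `t` and `p`
positive rational costs on every arc. -/
structure STNetwork (p : ℕ) where
  n : ℕ
  arcs : Finset (Fin n × Fin n)
  loopless : ∀ a ∈ arcs, a.1 ≠ a.2
  cost : Fin n × Fin n → Fin p → ℚ
  cost_pos : ∀ a ∈ arcs, ∀ i, 0 < cost a i
  s : Fin n
  t : Fin n
  s_ne_t : s ≠ t

/-- Encoding length: the number of vertices, and for every arc its two endpoints and its costs. -/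
def STNetwork.encLen {p : ℕ} (N : STNetwork p) : ℕ :=
  N.n + ∑ a ∈ N.arcs, (2 * Nat.size N.n + vecEnc (N.cost a))

/-- A (simple, directed) `s`-`t`-path, given by the list of its vertices. -/
def STNetwork.IsSTPath {p : ℕ} (N : STNetwork p) (l : List (Fin N.n)) : Prop :=
  l.Nodup ∧ l.IsChain (fun u v => (u, v) ∈ N.arcs) ∧ l.head? = some N.s ∧ l.getLast? = some N.t

/-- Multiobjective shortest path: minimize the sums of the costs of the arcs of an `s`-`t`-path. -/
def shortestPath (p : ℕ) : MOProblem p where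
  Instance := STNetwork p
  encLen N := N.encLen
  Solution N := {l : List (Fin N.n) // N.IsSTPath l}
  objective N l i := ((l.1.zip l.1.tail).map fun a => N.cost a i).sum
  sense := .minimize

/-- Multiobjective minimum `s`-`t`-cut: minimize, over all vertex sets `S` containing `s` but not `t`,
the sums of the costs of the arcs leaving `S`. -/
def minSTCut (p : ℕ) : MOProblem p where
  Instance := STNetwork p
  encLen N := N.encLen
  Solution N := {S : Finset (Fin N.n) // N.s ∈ S ∧ N.t ∉ S}
  objective N S i := ∑ a ∈ N.arcs with a.1 ∈ S.1 ∧ a.2 ∉ S.1, N.cost a i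
  sense := .minimize

/-- A finite simple undirected graph on the vertices `0, …, n - 1` with `p` positive rational costs on
every edge. -/
structure WeightedGraph (p : ℕ) where
  n : ℕ
  edges : Finset (Sym2 (Fin n))
  loopless : ∀ e ∈ edges, ¬ e.IsDiag
  cost : Sym2 (Fin n) → Fin p → ℚ
  cost_pos : ∀ e ∈ edges, ∀ i, 0 < cost e i

/-- Encoding length: the number of vertices, and for every edge its two endpoints and its costs. -/
def WeightedGraph.encLen {p : ℕ} (G : WeightedGraph p) : ℕ :=
  G.n + ∑ e ∈ G.edges, (2 * Nat.size G.n + vecEnc (G.cost e))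

/-- Multiobjective minimum spanning tree: minimize the sums of the costs of the edges of a spanning
tree, given by its edge set. -/
def minSpanningTree (p : ℕ) : MOProblem p where
  Instance := WeightedGraph p
  encLen G := G.encLen
  Solution G := {T : Finset (Sym2 (Fin G.n)) //
    T ⊆ G.edges ∧ (SimpleGraph.fromEdgeSet (T : Set (Sym2 (Fin G.n)))).IsTree}
  objective G T i := ∑ e ∈ T.1, G.cost e i
  sense := .minimize

/-- An `n × n` assignment instance with `p` positive rational costs for every pair. -/
structure AssignmentInstance (p : ℕ) where
  n : ℕ
  cost : Fin n → Fin n → Fin p → ℚ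
  cost_pos : ∀ j k i, 0 < cost j k i

/-- Multiobjective assignment: minimize the sums of the costs of a bijection between agents
and tasks. -/
def assignment (p : ℕ) : MOProblem p where
  Instance := AssignmentInstance p
  encLen A := A.n + ∑ j, ∑ k, vecEnc (A.cost j k)
  Solution A := Equiv.Perm (Fin A.n)
  objective A σ i := ∑ j, A.cost j (σ j) i
  sense := .minimize

/-- A knapsack instance: `n` items with positive rational weights and `p` positive rational profits
each, and a positive rational capacity. -/
structure KnapsackInstance (p : ℕ) where
  n : ℕ
  weight : Fin n → ℚ
  weight_pos : ∀ j, 0 < weight j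
  profit : Fin n → Fin p → ℚ
  profit_pos : ∀ j i, 0 < profit j i
  capacity : ℚ
  capacity_pos : 0 < capacity

/-- Multiobjective knapsack: maximize the total profits of a set of items whose total weight does not
exceed the capacity. The empty set, which is the only set whose profits are not positive, is not
counted as a feasible solution, since objective values are required to be positive. -/
def knapsack (p : ℕ) : MOProblem p where
  Instance := KnapsackInstance p
  encLen K := K.n + (∑ j, (ratEnc (K.weight j) + vecEnc (K.profit j))) + ratEnc K.capacity
  Solution K := {S : Finset (Fin K.n) // S.Nonempty ∧ ∑ j ∈ S, K.weight j ≤ K.capacity}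
  objective K S i := ∑ j ∈ S.1, K.profit j i
  sense := .maximize

/-- A (symmetric) traveling salesman instance: `n ≥ 3` cities and `p` positive rational distances
between any two distinct cities. -/
structure TSPInstance (p : ℕ) where
  n : ℕ
  three_le : 3 ≤ n
  dist : Sym2 (Fin n) → Fin p → ℚ
  dist_pos : ∀ e, ¬ e.IsDiag → ∀ i, 0 < dist e i

/-- Multiobjective traveling salesman: minimize the lengths of a tour through all cities. A tour is a
permutation of the cities that consists of a single cycle; from city `v` it moves on to `σ v`. -/
def travelingSalesman (p : ℕ) : MOProblem p where
  Instance := TSPInstance p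
  encLen T := T.n + ∑ e : Sym2 (Fin T.n) with ¬ e.IsDiag, vecEnc (T.dist e)
  Solution T := {σ : Equiv.Perm (Fin T.n) // σ.IsCycle ∧ σ.support = Finset.univ}
  objective T σ i := ∑ v, T.dist s(v, σ.1 v) i
  sense := .minimize

/-! Number the elements of a ground set `E` and give `e` the cost `2 ^ enumIndex e` in the first
half of the objectives and the complementary cost `t e * 2 ^ |E| - 2 ^ enumIndex e` in the second
half. A solution using the set `T` then has value `A(T) = ∑ 2 ^ enumIndex e` in the first half and
`t(T) * 2 ^ |E| - A(T)` in the second, and `A(T)` determines `T` by uniqueness of binary expansions.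

More than `⌈p / 2⌉` exact components always include one from each half (`exists_mem_halves`). If
`t(T')` is optimal, exact comparison of `T` with `T'` in the first half bounds `A(T)` on one side by
`A(T')`, and in the second half on the other side; hence `T = T'`. The relaxed components play no
role, so an approximation set must realize every set of optimal `t`-weight
(`IsQuasiExactApproximationSet.card_le_encard`).

The costs have polynomially many bits, so each problem only needs instances with exponentially many
solutions of optimal `t`-weight (`HasIntractableInstances.of_splitCost`). With `t = 1` this means
that the cardinality is constant (trees, permutations, tours, cuts of a suitable network) or bounded
by the capacity (knapsack). Paths vary in length, so there `t` is the length of a jump, which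
telescopes. -/

/-! ### Binary labels and complementary costs -/

/-- The position of `e` in a fixed enumeration of the finite type `E`. -/
noncomputable def enumIndex {E : Type*} [Fintype E] (e : E) : ℕ := Fintype.equivFin E e

theorem enumIndex_injective {E : Type*} [Fintype E] :
    Function.Injective (enumIndex : E → ℕ) := fun _ _ h =>
  (Fintype.equivFin E).injective (Fin.ext h)

theorem enumIndex_lt {E : Type*} [Fintype E] (e : E) : enumIndex e < Fintype.card E :=
  (Fintype.equivFin E e).2

/-- Uniqueness of binary expansions: a value in the first half of the objectives identifies the set.
-/
theorem sum_two_pow_enumIndex_injective {E : Type*} [Fintype E] :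
    Function.Injective fun T : Finset E => ∑ e ∈ T, 2 ^ enumIndex e := by
  classical
  intro T T' h
  have key : ∀ T : Finset E,
      ∑ e ∈ T, 2 ^ enumIndex e = ∑ m ∈ T.image enumIndex, 2 ^ m := fun T =>
    (Finset.sum_image (f := fun m => 2 ^ m) enumIndex_injective.injOn).symm
  simp only [key] at h
  exact Finset.image_injective enumIndex_injective (Finset.geomSum_injective le_rfl h)

/-- The cost vector of an element `e` of `E` for which the first half of the objectives is
`2 ^ enumIndex e` and the second half complements it to `t * 2 ^ |E|`. -/
noncomputable def splitCost (p : ℕ) {E : Type*} [Fintype E] (t : ℕ) (e : E) (i : Fin p) : ℚ :=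
  if 2 * (i : ℕ) < p then (2 ^ enumIndex e : ℕ)
  else ((t * 2 ^ Fintype.card E - 2 ^ enumIndex e : ℕ) : ℚ)

section splitCost

variable {p : ℕ} {E : Type*} [Fintype E]

theorem two_pow_enumIndex_lt {t : ℕ} (ht : 0 < t) (e : E) :
    2 ^ enumIndex e < t * 2 ^ Fintype.card E :=
  (Nat.pow_lt_pow_right one_lt_two (enumIndex_lt e)).trans_le (Nat.le_mul_of_pos_left _ ht)

theorem splitCost_pos {t : ℕ} (ht : 0 < t) (e : E) (i : Fin p) : 0 < splitCost p t e i := by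
  unfold splitCost
  split_ifs
  · positivity
  · exact_mod_cast Nat.sub_pos_of_lt (two_pow_enumIndex_lt ht e)

theorem ratEnc_natCast_le {a b : ℕ} (h : a < 2 ^ b) : ratEnc (a : ℚ) ≤ b + 1 := by
  simp only [ratEnc, Rat.num_natCast, Int.natAbs_natCast, Rat.den_natCast, Nat.size_one]
  exact Nat.add_le_add_right (Nat.size_le.2 h) 1

theorem vecEnc_splitCost_le (t : ℕ) (e : E) :
    vecEnc (splitCost p t e) ≤ p * (t + Fintype.card E + 1) := by
  have : ∀ i, ratEnc (splitCost p t e i) ≤ t + Fintype.card E + 1 := by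
    intro i
    unfold splitCost
    split_ifs
    · exact ratEnc_natCast_le (Nat.pow_lt_pow_right one_lt_two
        ((enumIndex_lt e).trans_le (Nat.le_add_left _ _)))
    · refine ratEnc_natCast_le ((Nat.sub_le _ _).trans_lt ?_)
      rw [pow_add]
      -- The crude bound `t < 2 ^ t` suffices, since all multipliers used are polynomial in the
      -- instance size.
      exact Nat.mul_lt_mul_of_pos_right Nat.lt_two_pow_self (by positivity)
  simpa [vecEnc] using Finset.sum_le_card_nsmul Finset.univ _ _ fun i _ => this i

theorem sum_splitCost_of_lt (t : E → ℕ) (T : Finset E) {i : Fin p} (hi : 2 * (i : ℕ) < p) :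
    ∑ e ∈ T, splitCost p (t e) e i = ((∑ e ∈ T, 2 ^ enumIndex e : ℕ) : ℚ) := by
  simp [splitCost, hi]

/-- Complementation survives summation; positivity of `t` makes each truncated subtraction in
`splitCost` exact. -/
theorem sum_splitCost_of_le {t : E → ℕ} {T : Finset E} (ht : ∀ e ∈ T, 0 < t e) {i : Fin p}
    (hi : p ≤ 2 * (i : ℕ)) :
    ∑ e ∈ T, splitCost p (t e) e i =
      ((∑ e ∈ T, t e : ℕ) : ℚ) * 2 ^ Fintype.card E - ((∑ e ∈ T, 2 ^ enumIndex e : ℕ) : ℚ) := by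
  push_cast
  rw [Finset.sum_mul, ← Finset.sum_sub_distrib]
  refine Finset.sum_congr rfl fun e he => ?_
  rw [splitCost, if_neg hi.not_gt, Nat.cast_sub (two_pow_enumIndex_lt (ht e he) e).le]
  push_cast
  rfl

end splitCost

/-! ### Lower bound on approximation sets -/

/-- A set of more than `⌈p / 2⌉` indices meets both halves of the index set. -/
theorem exists_mem_halves {p : ℕ} {S : Finset (Fin p)} (hS : ⌈(p : ℝ) / 2⌉₊ < S.card) :
    (∃ i ∈ S, 2 * (i : ℕ) < p) ∧ ∃ i ∈ S, p ≤ 2 * (i : ℕ) := by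
  have hp : p ≤ 2 * ⌈(p : ℝ) / 2⌉₊ := by
    have := Nat.le_ceil ((p : ℝ) / 2)
    have : (p : ℝ) ≤ 2 * (⌈(p : ℝ) / 2⌉₊ : ℝ) := by linarith
    exact_mod_cast this
  generalize ⌈(p : ℝ) / 2⌉₊ = c at hS hp
  -- Neither the last `c` nor the first `c` indices can exhaust `S`. Since `p ≤ 2 * c`, an index
  -- below `p - c` lies in the first half and an index at least `c` in the second.
  have bound : ∀ A : Finset ℕ, A.card ≤ c → ∃ i ∈ S, (i : ℕ) ∉ A := by
    intro A hA
    by_contra! h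
    have := Finset.card_le_card_of_injOn (s := S) (t := A) (fun i => (i : ℕ))
      (fun i hi => h i hi) Fin.val_injective.injOn
    omega
  constructor
  · obtain ⟨i, hi, h⟩ := bound (Finset.Ico (p - c) p) (by simp; omega)
    refine ⟨i, hi, ?_⟩
    have := i.2
    simp only [Finset.mem_Ico, not_and, not_lt] at h
    by_contra hc
    have := h (by omega)
    omega
  · obtain ⟨i, hi, h⟩ := bound (Finset.range c) (by simp)
    refine ⟨i, hi, ?_⟩
    simp only [Finset.mem_range, not_lt] at h
    omega

namespace MOProblem

variable {p : ℕ} {Pb : MOProblem p} {I : Pb.Instance}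

theorem objective_pos_of_splitCost {E : Type*} [Fintype E] {t : E → ℕ} {x : Pb.Solution I}
    {T : Finset E} (hobj : ∀ i, Pb.objective I x i = ∑ e ∈ T, splitCost p (t e) e i)
    (ht : ∀ e ∈ T, 0 < t e) (hT : T.Nonempty) (i : Fin p) : 0 < Pb.objective I x i := by
  rw [hobj]
  exact Finset.sum_pos (fun e he => splitCost_pos (ht e he) e i) hT

/-- If every solution `x` uses a set of elements with split costs and the `t`-weight of these sets is
optimal for a family of solutions using pairwise distinct sets, then a quasi-`k`-exact approximation
set with `k > ⌈p / 2⌉` is at least as large as the family. -/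
theorem IsQuasiExactApproximationSet.card_le_encard {E : Type*} [Fintype E] {t : E → ℕ}
    {used : Pb.Solution I → Finset E}
    (hobj : ∀ x i, Pb.objective I x i = ∑ e ∈ used x, splitCost p (t e) e i)
    (ht : ∀ x, ∀ e ∈ used x, 0 < t e) {C : ℕ}
    (hC : match Pb.sense with
      | .minimize => ∀ x, C ≤ ∑ e ∈ used x, t e
      | .maximize => ∀ x, ∑ e ∈ used x, t e ≤ C)
    {ι : Type*} [Fintype ι] {g : ι → Pb.Solution I} (hg : Function.Injective (used ∘ g))
    (hgC : ∀ j, ∑ e ∈ used (g j), t e = C) {k : ℕ} (hk : ⌈(p : ℝ) / 2⌉₊ < k) {ε : ℝ}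
    {P : Set (Pb.Solution I)} (hP : Pb.IsQuasiExactApproximationSet I k ε P) :
    (Fintype.card ι : ℕ∞) ≤ P.encard := by
  have key : ∀ j, ∃ x ∈ P, used x = used (g j) := by
    intro j
    obtain ⟨x, hxP, S, hSk, hS⟩ := hP (g j)
    refine ⟨x, hxP, sum_two_pow_enumIndex_injective ?_⟩
    obtain ⟨⟨i₁, hi₁, h₁⟩, i₂, hi₂, h₂⟩ := exists_mem_halves (hSk ▸ hk)
    have hpos : (0 : ℚ) < 2 ^ Fintype.card E := by positivity
    have hCj := hgC j
    rw [Approximates] at hS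
    cases hs : Pb.sense <;> simp only [hs] at hS hC
    -- Optimality of `C`, scaled to `hx'`, removes the multiple of `2 ^ |E|` from `e₂`, leaving the
    -- reverse of `e₁`. Which of the two inequalities `e₁` supplies depends on the sense, hence the
    -- `first` alternatives.
    all_goals
      have e₁ := hS i₁
      have e₂ := hS i₂
      simp only [hi₁, hi₂, if_true, one_mul, Rat.cast_le, hobj, sum_splitCost_of_lt _ _ h₁,
        sum_splitCost_of_le (ht _) h₂, Nat.cast_le] at e₁ e₂
      have hx : ((_ : ℕ) : ℚ) ≤ (_ : ℕ) := Nat.cast_le.2 (hC x)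
      have hx' := mul_le_mul_of_nonneg_right hx hpos.le
      rw [hCj] at e₂
      refine le_antisymm ?_ ?_
      · first
        | exact e₁
        | exact Nat.cast_le (α := ℚ).1 (by linarith)
      · first
        | exact e₁
        | exact Nat.cast_le (α := ℚ).1 (by linarith)
  choose f hfP hf using key
  have hinj : Function.Injective f := fun a b hab => hg (by
    simp only [Function.comp, ← hf, hab])
  calc (Fintype.card ι : ℕ∞) = ENat.card ι := by simp
    _ = (Set.range f).encard := by
      rw [← Set.image_univ, hinj.encard_image, Set.encard_univ]
    _ ≤ P.encard := Set.encard_le_encard (Set.range_subset_iff.2 hfP)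

end MOProblem

/-! ### Polynomial against exponential growth, and the criterion -/

theorem Polynomial.eval_mono_nat (Q : Polynomial ℕ) {a b : ℕ} (h : a ≤ b) :
    Q.eval a ≤ Q.eval b := by
  simp only [Polynomial.eval_eq_sum]
  exact Finset.sum_le_sum fun i _ => Nat.mul_le_mul_left _ (Nat.pow_le_pow_left h i)

theorem Polynomial.eventually_eval_lt_two_pow (Q : Polynomial ℕ) :
    ∀ᶠ n : ℕ in Filter.atTop, Q.eval n < 2 ^ n := by
  have h : Filter.Tendsto (fun n : ℕ => ((Q.eval n : ℕ) : ℝ) / 2 ^ n) Filter.atTop (nhds 0) := by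
    have e : (fun n : ℕ => ((Q.eval n : ℕ) : ℝ) / 2 ^ n) =
        fun n : ℕ => ∑ i ∈ Q.support, (Q.coeff i : ℝ) * ((n : ℝ) ^ i / 2 ^ n) := by
      funext n
      simp only [Polynomial.eval_eq_sum, Polynomial.sum_def]
      push_cast
      rw [Finset.sum_div]
      exact Finset.sum_congr rfl fun i _ => by ring
    rw [e, show nhds (0 : ℝ) = nhds (∑ i ∈ Q.support, 0) by simp]
    refine tendsto_finsetSum _ fun i _ => ?_
    simpa using (tendsto_pow_const_div_const_pow_of_one_lt i (one_lt_two (α := ℝ))).const_mul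
      (Q.coeff i : ℝ)
  filter_upwards [h.eventually_lt_const one_pos] with n hn
  rw [div_lt_one (by positivity)] at hn
  exact_mod_cast hn

/-- `Pb` has instances with positive objective values that admit no quasi-`k`-exact approximation
sets of polynomial cardinality for `k > ⌈p / 2⌉`. -/
def MOProblem.HasIntractableInstances {p : ℕ} (Pb : MOProblem p) : Prop :=
  ∃ I : ℕ → Pb.Instance,
    (∀ n x i, 0 < Pb.objective (I n) x i) ∧
    ∀ Q : Polynomial ℕ, ∀ᶠ n in Filter.atTop,
      ∀ k : ℕ, ⌈(p : ℝ) / 2⌉₊ < k → ∀ ε : ℝ, 0 < ε →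
        ∀ P : Set (Pb.Solution (I n)),
          Pb.IsQuasiExactApproximationSet (I n) k ε P →
            ((Q.eval (Pb.encLen (I n)) : ℕ) : ℕ∞) < P.encard

/-- A criterion for `HasIntractableInstances`: instances of polynomial encoding length in which
solutions use sets of elements with split costs, with exponentially many different sets among those
of optimal `t`-weight. -/
theorem MOProblem.HasIntractableInstances.of_splitCost {p : ℕ} {Pb : MOProblem p}
    (I : ℕ → Pb.Instance) (R : Polynomial ℕ) (hR : ∀ n, Pb.encLen (I n) ≤ R.eval n)
    {E : ℕ → Type} [∀ n, Fintype (E n)] (t : ∀ n, E n → ℕ)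
    (used : ∀ n, Pb.Solution (I n) → Finset (E n))
    (hobj : ∀ n x i, Pb.objective (I n) x i = ∑ e ∈ used n x, splitCost p (t n e) e i)
    (ht : ∀ n x, ∀ e ∈ used n x, 0 < t n e) (hne : ∀ n x, (used n x).Nonempty)
    (C : ℕ → ℕ)
    (hC : ∀ n, match Pb.sense with
      | .minimize => ∀ x, C n ≤ ∑ e ∈ used n x, t n e
      | .maximize => ∀ x, ∑ e ∈ used n x, t n e ≤ C n)
    {ι : ℕ → Type} [∀ n, Fintype (ι n)] (hι : ∀ n, 2 ^ n ≤ Fintype.card (ι n))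
    (g : ∀ n, ι n → Pb.Solution (I n)) (hg : ∀ n, Function.Injective (used n ∘ g n))
    (hgC : ∀ n j, ∑ e ∈ used n (g n j), t n e = C n) :
    Pb.HasIntractableInstances := by
  refine ⟨I, fun n x i => objective_pos_of_splitCost (hobj n x) (ht n x) (hne n x) i, fun Q => ?_⟩
  -- Monotonicity of `Q` gives `Q(enc) ≤ Q(R(n))`, which is eventually below `2 ^ n`.
  filter_upwards [(Q.comp R).eventually_eval_lt_two_pow] with n hn k hk ε _ P hP
  refine lt_of_lt_of_le ?_
    (hP.card_le_encard (hobj n) (ht n) (hC n) (hg n) (hgC n) hk)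
  rw [Polynomial.eval_comp] at hn
  exact_mod_cast ((Q.eval_mono_nat (hR n)).trans_lt hn).trans_le (hι n)

/-! ### Assignment -/

/-- The graph of a permutation. -/
def Equiv.Perm.graphFinset {N : ℕ} (σ : Equiv.Perm (Fin N)) : Finset (Fin N × Fin N) :=
  Finset.univ.image fun j => (j, σ j)

theorem Equiv.Perm.card_graphFinset {N : ℕ} (σ : Equiv.Perm (Fin N)) : σ.graphFinset.card = N := by
  rw [graphFinset, Finset.card_image_of_injective _ fun a b h => congrArg Prod.fst h]
  simp

theorem Equiv.Perm.sum_graphFinset {N : ℕ} (σ : Equiv.Perm (Fin N)) (f : Fin N × Fin N → ℚ) :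
    ∑ e ∈ σ.graphFinset, f e = ∑ j, f (j, σ j) :=
  Finset.sum_image fun _ _ _ _ h => congrArg Prod.fst h

theorem Equiv.Perm.graphFinset_injective {N : ℕ} :
    Function.Injective (graphFinset : Equiv.Perm (Fin N) → Finset (Fin N × Fin N)) := by
  intro σ τ h
  ext j
  have hj : (j, σ j) ∈ τ.graphFinset := h ▸ Finset.mem_image_of_mem _ (Finset.mem_univ j)
  simp only [graphFinset, Finset.mem_image, Finset.mem_univ, true_and, Prod.mk.injEq,
    exists_eq_left] at hj
  rw [hj]

theorem two_pow_le_factorial_succ (n : ℕ) : 2 ^ n ≤ (n + 1).factorial := by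
  induction n with
  | zero => simp
  | succ n ih =>
    rw [Nat.factorial_succ, pow_succ']
    exact Nat.mul_le_mul (by omega) ih

open Polynomial in
theorem assignment_hasIntractableInstances (p : ℕ) : (assignment p).HasIntractableInstances := by
  refine MOProblem.HasIntractableInstances.of_splitCost (Pb := assignment p)
    (E := fun n => Fin (n + 1) × Fin (n + 1)) (ι := fun n => Equiv.Perm (Fin (n + 1)))
    (fun n =>
      { n := n + 1
        cost := fun j k => splitCost p 1 (j, k)
        cost_pos := fun j k i => splitCost_pos one_pos _ i })
    (X + 1 + (X + 1) * ((X + 1) * (C p * (1 + (X + 1) * (X + 1) + 1)))) ?_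
    (fun _ _ => 1) (fun n σ => Equiv.Perm.graphFinset σ) ?_ (fun _ _ _ _ => one_pos)
    (fun n σ => Finset.univ_nonempty.image _) (fun n => n + 1) ?_ ?_ (fun n σ => σ)
    (fun n => Equiv.Perm.graphFinset_injective) ?_
  · intro n
    simp only [assignment, eval_add, eval_X, eval_one, eval_mul, eval_C]
    refine Nat.add_le_add_left ?_ _
    refine (Finset.sum_le_card_nsmul Finset.univ _ _ fun j _ =>
      Finset.sum_le_card_nsmul Finset.univ _ _ fun k _ => vecEnc_splitCost_le _ _).trans ?_
    simp
  · exact fun n σ i => (Equiv.Perm.sum_graphFinset σ fun e => splitCost p 1 e i).symm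
  · exact fun n σ =>
      ((Finset.card_eq_sum_ones _).symm.trans (Equiv.Perm.card_graphFinset σ)).ge
  · intro n
    rw [Fintype.card_perm, Fintype.card_fin]
    exact two_pow_le_factorial_succ n
  · exact fun n σ => (Finset.card_eq_sum_ones _).symm.trans (Equiv.Perm.card_graphFinset σ)

/-! ### Knapsack: unit weights, with capacity for half of the items -/

open Polynomial in
theorem knapsack_hasIntractableInstances (p : ℕ) : (knapsack p).HasIntractableInstances := by
  refine MOProblem.HasIntractableInstances.of_splitCost (Pb := knapsack p)
    (E := fun n => Fin (2 * (n + 1)))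
    (ι := fun n => Finset.powersetCard (n + 1) (Finset.univ : Finset (Fin (2 * (n + 1)))))
    (fun n =>
      { n := 2 * (n + 1)
        weight := fun _ => 1
        weight_pos := fun _ => one_pos
        profit := fun j => splitCost p 1 j
        profit_pos := fun j i => splitCost_pos one_pos _ i
        capacity := (n + 1 : ℕ)
        capacity_pos := by positivity })
    (2 * (X + 1) + 2 * (X + 1) * (2 + C p * (1 + 2 * (X + 1) + 1)) + (X + 2)) ?_
    (fun _ _ => 1) (fun n S => S.1)
    (fun _ _ _ => rfl) (fun _ _ _ _ => one_pos) (fun n S => S.2.1) (fun n => n + 1) ?_ ?_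
    (fun n S => ⟨S.1, ?_, ?_⟩) ?_ ?_
  · intro n
    simp only [knapsack, eval_add, eval_X, eval_one, eval_mul, eval_C, eval_ofNat]
    refine Nat.add_le_add (Nat.add_le_add_left ?_ _) ?_
    · refine (Finset.sum_le_card_nsmul Finset.univ _ _ fun j _ =>
        Nat.add_le_add_left (vecEnc_splitCost_le _ _) _).trans ?_
      simp [ratEnc]
    · exact ratEnc_natCast_le Nat.lt_two_pow_self
  · intro n S
    have h : ∑ j ∈ S.1, (1 : ℚ) ≤ (n + 1 : ℕ) := S.2.2
    rw [Finset.sum_const, nsmul_one, Nat.cast_le] at h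
    simpa using h
  · intro n
    rw [Fintype.card_coe, Finset.card_powersetCard, Finset.card_univ, Fintype.card_fin]
    induction n with
    | zero => simp
    | succ n ih =>
      -- Consecutive central binomial coefficients have ratio `2 * (2 * n + 3) / (n + 2) ≥ 2`.
      have := Nat.succ_mul_centralBinom_succ (n + 1)
      simp only [Nat.centralBinom_eq_two_mul_choose] at this
      rw [pow_succ']
      refine Nat.le_of_mul_le_mul_left (c := n + 2) ?_ (by omega)
      rw [this]
      nlinarith
  · exact Finset.card_pos.1 (by rw [(Finset.mem_powersetCard.1 S.2).2]; omega)
  · simp [(Finset.mem_powersetCard.1 S.2).2]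
  · exact fun n S T h => Subtype.ext h
  · intro n S
    simp [(Finset.mem_powersetCard.1 S.2).2]

/-! ### Minimum cut: a network all of whose cuts have equally many arcs -/

/-- The bound on the encoding length of networks and graphs with `N` vertices, at most `m` arcs and
split costs with multipliers at most `τ`, over a type with `M` elements. -/
theorem add_sum_enc_le {p : ℕ} {E : Type*} [Fintype E] (N : ℕ) (A : Finset E) (t : E → ℕ) {τ : ℕ}
    (ht : ∀ e ∈ A, t e ≤ τ) :
    N + ∑ e ∈ A, (2 * Nat.size N + vecEnc (splitCost p (t e) e)) ≤
      N + Fintype.card E * (2 * N + p * (τ + Fintype.card E + 1)) := by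
  refine Nat.add_le_add_left ?_ _
  refine (Finset.sum_le_card_nsmul A _ _ fun e he => ?_).trans
    (Nat.mul_le_mul_right _ A.card_le_univ)
  have h₁ := vecEnc_splitCost_le (p := p) (t e) e
  have h₂ : Nat.size N ≤ N := Nat.size_le.2 Nat.lt_two_pow_self
  have h₃ : p * (t e + Fintype.card E + 1) ≤ p * (τ + Fintype.card E + 1) :=
    Nat.mul_le_mul_left _ (by have := ht e he; omega)
  omega

/-- The arcs from `s` and the arcs to `t`. -/
def fanArcs {N : ℕ} (s t : Fin N) : Finset (Fin N × Fin N) :=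
  Finset.univ.filter fun a => (a.1 = s ∨ a.2 = t) ∧ a.1 ≠ a.2

/-- Each vertex `v ≠ s` accounts for exactly one cut arc: `(v, t)` if `v ∈ S`, and `(s, v)`
otherwise. The number of cut arcs is therefore independent of `S`. -/
theorem card_fanArcs_cut {N : ℕ} {s t : Fin N} {S : Finset (Fin N)} (hs : s ∈ S)
    (ht : t ∉ S) :
    ((fanArcs s t).filter fun a => a.1 ∈ S ∧ a.2 ∉ S).card + 1 = N := by
  have h : (fanArcs s t).filter (fun a => a.1 ∈ S ∧ a.2 ∉ S) =
      (Finset.univ.erase s).image fun v => if v ∈ S then (v, t) else (s, v) := by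
    ext ⟨x, y⟩
    simp only [fanArcs, Finset.mem_filter, Finset.mem_univ, true_and, Finset.mem_image,
      Finset.mem_erase, and_true]
    constructor
    · rintro ⟨⟨rfl | rfl, h⟩, hx, hy⟩
      · exact ⟨y, fun e => h e.symm, by simp [hy]⟩
      -- The arc `(s, t)` belongs to both fans; it is charged to `t`.
      · by_cases e : x = s
        · subst e
          exact ⟨y, fun e => h e.symm, by simp [hy]⟩
        · exact ⟨x, e, by simp [hx]⟩
    · rintro ⟨v, hv, h⟩
      split_ifs at h with hvS
      · obtain ⟨rfl, rfl⟩ := Prod.mk.inj h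
        exact ⟨⟨Or.inr rfl, fun e => ht (e ▸ hvS)⟩, hvS, ht⟩
      · obtain ⟨rfl, rfl⟩ := Prod.mk.inj h
        exact ⟨⟨Or.inl rfl, fun e => hv e.symm⟩, hs, hvS⟩
  rw [h, Finset.card_image_of_injOn, Finset.card_erase_of_mem (Finset.mem_univ _),
    Finset.card_univ, Fintype.card_fin]
  · have := s.2
    omega
  · intro v hv w hw e
    have hv' := Finset.ne_of_mem_erase hv
    have hw' := Finset.ne_of_mem_erase hw
    simp only at e
    split_ifs at e <;> simp_all

open Polynomial in
theorem minSTCut_hasIntractableInstances (p : ℕ) : (minSTCut p).HasIntractableInstances := by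
  -- An interior vertex lies on the source side exactly when its arc to the sink is cut, so the cut
  -- arcs determine `B`.
  have mem : ∀ {n : ℕ} (S : Finset (Fin (n + 2))) (v : Fin n),
      (v.succ.castSucc, Fin.last (n + 1)) ∈
        ((fanArcs 0 (Fin.last (n + 1))).filter fun a => a.1 ∈ S ∧ a.2 ∉ S) ↔
      v.succ.castSucc ∈ S ∧ Fin.last (n + 1) ∉ S := fun S v => by
    simp [fanArcs, Fin.castSucc_ne_last]
  refine MOProblem.HasIntractableInstances.of_splitCost (Pb := minSTCut p)
    (E := fun n => Fin (n + 2) × Fin (n + 2)) (ι := fun n => Finset (Fin n))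
    (fun n =>
      { n := n + 2
        arcs := fanArcs 0 (Fin.last _)
        loopless := fun a ha => (Finset.mem_filter.1 ha).2.2
        cost := fun a => splitCost p 1 a
        cost_pos := fun a _ i => splitCost_pos one_pos _ i
        s := 0
        t := Fin.last _
        s_ne_t := (Fin.last_pos).ne })
    (X + 2 + (X + 2) * (X + 2) * (2 * (X + 2) + C p * (1 + (X + 2) * (X + 2) + 1))) ?_
    (fun _ _ => 1)
    (fun n S => (fanArcs 0 (Fin.last _)).filter fun a => a.1 ∈ S.1 ∧ a.2 ∉ S.1)
    (fun _ _ _ => rfl) (fun _ _ _ _ => one_pos) ?_ (fun n => n + 1) ?_ ?_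
    (fun n B => ⟨insert 0 (B.map ⟨fun v => v.succ.castSucc, fun a b h => by simpa using h⟩),
      Finset.mem_insert_self _ _, ?_⟩) ?_ ?_
  · intro n
    have := add_sum_enc_le (p := p) (n + 2) (fanArcs 0 (Fin.last (n + 1))) (fun _ => 1)
      (τ := 1) (fun _ _ => le_rfl)
    simp only [Fintype.card_prod, Fintype.card_fin] at this
    simp only [eval_add, eval_X, eval_mul, eval_C, eval_ofNat, eval_one]
    exact this
  · rintro n ⟨S, hs, ht⟩
    have h : ((fanArcs 0 (Fin.last (n + 1))).filter fun a => a.1 ∈ S ∧ a.2 ∉ S).card + 1 = n + 2 :=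
      card_fanArcs_cut hs ht
    exact Finset.card_pos.1 (n.succ_pos.trans_eq (Nat.succ.inj h).symm)
  · rintro n ⟨S, hs, ht⟩
    have h : ((fanArcs 0 (Fin.last (n + 1))).filter fun a => a.1 ∈ S ∧ a.2 ∉ S).card + 1 = n + 2 :=
      card_fanArcs_cut hs ht
    exact ((Finset.card_eq_sum_ones _).symm.trans (Nat.succ.inj h)).ge
  · intro n
    simp
  · simp [Fin.castSucc_ne_last, (Fin.last_pos).ne']
  · intro n A B h
    ext v
    have hA := mem (insert 0 (A.map ⟨fun v => v.succ.castSucc, fun a b h => by simpa using h⟩)) v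
    have hB := mem (insert 0 (B.map ⟨fun v => v.succ.castSucc, fun a b h => by simpa using h⟩)) v
    have h' := hA.symm.trans ((Finset.ext_iff.1 h _).trans hB)
    simpa [Fin.castSucc_ne_last, (Fin.last_pos).ne', Fin.succ_ne_zero] using h'
  · intro n B
    simp only [Finset.sum_const, smul_eq_mul, mul_one]
    have := card_fanArcs_cut (s := (0 : Fin (n + 2))) (t := Fin.last _)
      (S := insert 0 (B.map ⟨fun v => v.succ.castSucc, fun a b h => by simpa using h⟩))
      (Finset.mem_insert_self _ _) (by simp [Fin.castSucc_ne_last, (Fin.last_pos).ne'])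
    omega

/-! ### Minimum spanning tree: double stars in the complete graph -/

/-- The edge set of the tree on `n + 2` vertices in which `0` and `1` are adjacent and `i + 2` is a leaf
attached to `1` for `i ∈ B` and to `0` for `i ∉ B`. -/
def doubleStar {n : ℕ} (B : Finset (Fin n)) : Finset (Sym2 (Fin (n + 2))) :=
  insert s(0, 1) (Finset.univ.image fun i : Fin n => s(if i ∈ B then 1 else 0, i.succ.succ))

/-- Recovers `B` from the edge set, so different `B` give different trees. -/
theorem mem_doubleStar {n : ℕ} (B : Finset (Fin n)) (i : Fin n) :
    s(1, i.succ.succ) ∈ doubleStar B ↔ i ∈ B := by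
  simp only [doubleStar, Finset.mem_insert, Finset.mem_image, Finset.mem_univ, true_and]
  constructor
  · rintro (h | ⟨j, h⟩)
    · simp [Fin.ext_iff] at h
    · split_ifs at h with hj <;> simp [Fin.ext_iff] at h
      exact Fin.ext h ▸ hj
  · exact fun h => Or.inr ⟨i, by simp [h]⟩

theorem not_isDiag_of_mem_doubleStar {n : ℕ} {B : Finset (Fin n)} {e : Sym2 (Fin (n + 2))}
    (he : e ∈ doubleStar B) : ¬ e.IsDiag := by
  simp only [doubleStar, Finset.mem_insert, Finset.mem_image, Finset.mem_univ, true_and] at he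
  rcases he with rfl | ⟨j, rfl⟩
  · simp
  · split_ifs <;> simp [Fin.ext_iff]

/-- `fromEdgeSet` discards loops, so the count is exact for loopless `T`. -/
theorem SimpleGraph.card_edgeSet_fromEdgeSet {V : Type*} {T : Finset (Sym2 V)}
    (hT : ∀ e ∈ T, ¬ e.IsDiag) :
    Nat.card (SimpleGraph.fromEdgeSet (T : Set (Sym2 V))).edgeSet = T.card := by
  have h : (SimpleGraph.fromEdgeSet (T : Set (Sym2 V))).edgeSet = T := by
    rw [SimpleGraph.edgeSet_fromEdgeSet, sdiff_eq_left, Set.disjoint_left]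
    exact hT
  rw [h]
  simp

theorem doubleStar_isTree {n : ℕ} (B : Finset (Fin n)) :
    (SimpleGraph.fromEdgeSet (doubleStar B : Set (Sym2 (Fin (n + 2))))).IsTree := by
  have adj : ∀ {u v}, u ≠ v → s(u, v) ∈ doubleStar B →
      (SimpleGraph.fromEdgeSet (doubleStar B : Set (Sym2 (Fin (n + 2))))).Reachable u v :=
    fun h he => SimpleGraph.Adj.reachable ((SimpleGraph.fromEdgeSet_adj _).2 ⟨he, h⟩)
  have h01 := adj (u := 0) (v := 1) (by simp) (Finset.mem_insert_self _ _)
  have reach : ∀ v,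
      (SimpleGraph.fromEdgeSet (doubleStar B : Set (Sym2 (Fin (n + 2))))).Reachable 0 v := by
    intro v
    refine Fin.cases (SimpleGraph.Reachable.refl _) (fun v => ?_) v
    refine Fin.cases h01 (fun i => ?_) v
    have hmem : s(if i ∈ B then 1 else 0, i.succ.succ) ∈ doubleStar B :=
      Finset.mem_insert_of_mem (Finset.mem_image_of_mem _ (Finset.mem_univ i))
    split_ifs at hmem
    · exact h01.trans (adj (by simp [Fin.ext_iff]) hmem)
    · exact adj (by simp [Fin.ext_iff]) hmem
  rw [SimpleGraph.isTree_iff_connected_and_card,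
    SimpleGraph.card_edgeSet_fromEdgeSet fun e he => not_isDiag_of_mem_doubleStar he]
  have hconn : (SimpleGraph.fromEdgeSet (doubleStar B : Set (Sym2 (Fin (n + 2))))).Connected :=
    (SimpleGraph.connected_iff _).2 ⟨fun u v => (reach u).symm.trans (reach v), inferInstance⟩
  -- The construction lists at most `n + 1` edges; connectivity forces at least that many, so no
  -- distinctness check is needed.
  refine ⟨hconn, le_antisymm ?_ ?_⟩
  · have h₁ := Finset.card_insert_le s(0, 1)
      (Finset.univ.image fun i : Fin n => s(if i ∈ B then 1 else (0 : Fin (n + 2)), i.succ.succ))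
    have h₂ := Finset.card_image_le (s := Finset.univ)
      (f := fun i : Fin n => s(if i ∈ B then 1 else (0 : Fin (n + 2)), i.succ.succ))
    simp only [Finset.card_univ, Fintype.card_fin] at h₂
    simp only [Nat.card_eq_fintype_card, Fintype.card_fin, doubleStar]
    omega
  · have := hconn.card_vert_le_card_edgeSet_add_one
    rwa [SimpleGraph.card_edgeSet_fromEdgeSet fun e he => not_isDiag_of_mem_doubleStar he] at this

open Polynomial in
theorem minSpanningTree_hasIntractableInstances (p : ℕ) :
    (minSpanningTree p).HasIntractableInstances := by
  have card_tree : ∀ {n : ℕ} {T : Finset (Sym2 (Fin (n + 2)))}, (∀ e ∈ T, ¬ e.IsDiag) →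
      (SimpleGraph.fromEdgeSet (T : Set (Sym2 (Fin (n + 2))))).IsTree → T.card = n + 1 := by
    intro n T hT h
    have := (SimpleGraph.isTree_iff_connected_and_card.1 h).2
    rw [SimpleGraph.card_edgeSet_fromEdgeSet hT] at this
    simpa using this
  refine MOProblem.HasIntractableInstances.of_splitCost (Pb := minSpanningTree p)
    (E := fun n => Sym2 (Fin (n + 2))) (ι := fun n => Finset (Fin n))
    (fun n =>
      { n := n + 2
        edges := Finset.univ.filter fun e => ¬ e.IsDiag
        loopless := fun e he => (Finset.mem_filter.1 he).2
        cost := fun e => splitCost p 1 e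
        cost_pos := fun e _ i => splitCost_pos one_pos _ i })
    -- The ground set includes the diagonal, so it has `(n + 3).choose 2 ≤ (n + 3) ^ 2` elements.
    (X + 2 + (X + 3) * (X + 3) * (2 * (X + 2) + C p * (1 + (X + 3) * (X + 3) + 1))) ?_
    (fun _ _ => 1) (fun n T => T.1) (fun _ _ _ => rfl) (fun _ _ _ _ => one_pos) ?_
    (fun n => n + 1) ?_ ?_
    (fun n B => ⟨doubleStar B, fun e he => Finset.mem_filter.2
      ⟨Finset.mem_univ _, not_isDiag_of_mem_doubleStar he⟩, doubleStar_isTree B⟩) ?_ ?_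
  · intro n
    refine (add_sum_enc_le (p := p) (n + 2) (Finset.univ.filter fun e => ¬ e.IsDiag)
      (fun _ : Sym2 (Fin (n + 2)) => 1) (τ := 1) (fun _ _ => le_rfl)).trans ?_
    have hcard : Fintype.card (Sym2 (Fin (n + 2))) ≤ (n + 3) * (n + 3) := by
      rw [Sym2.card, Fintype.card_fin]
      exact (Nat.choose_le_pow _ _).trans_eq (sq _)
    simp only [eval_add, eval_X, eval_mul, eval_C, eval_ofNat, eval_one]
    gcongr
  · intro n T
    have : T.1.card = n + 1 := card_tree (fun e he => (Finset.mem_filter.1 (T.2.1 he)).2) T.2.2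
    exact Finset.card_pos.1 (by omega)
  · intro n T
    have : T.1.card = n + 1 := card_tree (fun e he => (Finset.mem_filter.1 (T.2.1 he)).2) T.2.2
    simp [this]
  · intro n
    simp
  · intro n A B h
    ext v
    rw [← mem_doubleStar, ← mem_doubleStar, show doubleStar A = doubleStar B from h]
  · intro n B
    simp [card_tree (fun e he => not_isDiag_of_mem_doubleStar he) (doubleStar_isTree B)]

/-! ### Shortest path: increasing paths in a transitive tournament -/

theorem List.mem_zip_tail_of_isChain {α : Type*} {r : α → α → Prop} {l : List α}
    (h : l.IsChain r) {a : α × α} (ha : a ∈ l.zip l.tail) : r a.1 a.2 := by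
  induction l with
  | nil => simp at ha
  | cons x l ih =>
    cases l with
    | nil => simp at ha
    | cons y l =>
      rw [List.isChain_cons_cons] at h
      simp only [List.tail_cons, List.zip_cons_cons, List.mem_cons] at ha
      rcases ha with rfl | ha
      · exact h.1
      · exact ih h.2 ha

/-- Telescoping; the list increases, so no difference is truncated. -/
theorem List.sum_sub_zip_tail {l : List ℕ} (h : l.IsChain (· < ·)) :
    ∀ {s t : ℕ}, l.head? = some s → l.getLast? = some t →
      ((l.zip l.tail).map fun a => a.2 - a.1).sum + s = t := by
  induction l with
  | nil => simp
  | cons x l ih =>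
    intro s t hs ht
    cases l with
    | nil => simp_all
    | cons y l =>
      rw [List.isChain_cons_cons] at h
      rw [List.getLast?_cons_cons] at ht
      have := ih h.2 rfl ht
      simp only [List.head?_cons, Option.some.injEq] at hs
      simp only [List.tail_cons, List.zip_cons_cons, List.map_cons, List.sum_cons] at this ⊢
      omega

theorem List.Nodup.zip_tail {α : Type*} {l : List α} (h : l.Nodup) : (l.zip l.tail).Nodup := by
  refine List.Nodup.of_map Prod.snd ?_
  rw [List.map_snd_zip (by simp)]
  exact h.tail

/-- The heads of the arcs are the vertices after the first, so the arc set determines which interior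
vertices are visited. -/
theorem List.image_snd_zip_tail {α : Type*} [DecidableEq α] (l : List α) :
    (l.zip l.tail).toFinset.image Prod.snd = l.tail.toFinset := by
  have h := List.map_snd_zip (l₁ := l) (l₂ := l.tail) (by simp)
  ext a
  simp only [Finset.mem_image, List.mem_toFinset]
  conv_rhs => rw [← h]
  simp

theorem List.sum_toFinset_zip_tail_sub {N : ℕ} {l : List (Fin N)} (hl : l.Nodup)
    (h : l.IsChain (· < ·)) {s t : Fin N} (hs : l.head? = some s) (ht : l.getLast? = some t) :
    ∑ a ∈ (l.zip l.tail).toFinset, ((a.2 : ℕ) - a.1) + s = t := by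
  rw [List.sum_toFinset _ hl.zip_tail]
  have := List.sum_sub_zip_tail (l := l.map Fin.val) (s := s) (t := t)
    (List.isChain_map_of_isChain Fin.val (fun _ _ h => h) h) (by simp [hs]) (by simp [ht])
  rw [← List.map_tail, List.zip_map, List.map_map] at this
  exact this

/-- The increasing list of vertices with first vertex `0`, interior vertices `B` and last vertex
`n + 1`. -/
def pathThrough {n : ℕ} (B : Finset (Fin n)) : List (Fin (n + 2)) :=
  0 :: (((List.finRange n).filter (· ∈ B)).map (fun v => v.succ.castSucc) ++ [Fin.last _])

theorem pairwise_pathThrough {n : ℕ} (B : Finset (Fin n)) : (pathThrough B).Pairwise (· < ·) := by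
  have h : ((List.finRange n).filter (· ∈ B)).Pairwise (· < ·) :=
    (List.pairwise_lt_finRange n).filter _
  simp only [pathThrough, List.pairwise_cons, List.pairwise_append, List.pairwise_map,
    List.mem_append, List.mem_map, List.mem_singleton]
  refine ⟨?_, ?_, by simp, ?_⟩
  · rintro _ (⟨v, -, rfl⟩ | rfl)
    · exact Fin.castSucc_pos (Fin.succ_pos v)
    · exact Fin.last_pos
  · exact h.imp fun h => Fin.castSucc_lt_castSucc_iff.2 (Fin.succ_lt_succ_iff.2 h)
  · rintro _ ⟨v, -, rfl⟩ _ rfl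
    exact Fin.castSucc_lt_last _

theorem getLast?_pathThrough {n : ℕ} (B : Finset (Fin n)) :
    (pathThrough B).getLast? = some (Fin.last (n + 1)) := by
  rw [pathThrough, ← List.cons_append, List.getLast?_concat]

theorem mem_tail_pathThrough {n : ℕ} (B : Finset (Fin n)) (v : Fin n) :
    v.succ.castSucc ∈ (pathThrough B).tail ↔ v ∈ B := by
  simp [pathThrough, Fin.castSucc_ne_last]

open Polynomial in
theorem shortestPath_hasIntractableInstances (p : ℕ) :
    (shortestPath p).HasIntractableInstances := by
  have lt_of_mem : ∀ {n : ℕ} {a : Fin (n + 2) × Fin (n + 2)},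
      a ∈ Finset.univ.filter (fun a : Fin (n + 2) × Fin (n + 2) => a.1 < a.2) → a.1 < a.2 :=
    fun h => (Finset.mem_filter.1 h).2
  have isChain : ∀ {n : ℕ} {l : List (Fin (n + 2))}, l.IsChain (fun u v =>
      (u, v) ∈ Finset.univ.filter (fun a : Fin (n + 2) × Fin (n + 2) => a.1 < a.2)) →
      l.IsChain (· < ·) := fun h => h.imp fun _ _ h => lt_of_mem h
  refine MOProblem.HasIntractableInstances.of_splitCost (Pb := shortestPath p)
    (E := fun n => Fin (n + 2) × Fin (n + 2)) (ι := fun n => Finset (Fin n))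
    (fun n =>
      { n := n + 2
        arcs := Finset.univ.filter fun a => a.1 < a.2
        loopless := fun a ha => (lt_of_mem ha).ne
        -- Weighting an arc by its jump gives every path from `0` to `n + 1` total weight `n + 1`,
        -- however many arcs it has.
        cost := fun a => splitCost p ((a.2 : ℕ) - a.1) a
        cost_pos := fun a ha i => splitCost_pos (Nat.sub_pos_of_lt (lt_of_mem ha)) _ i
        s := 0
        t := Fin.last _
        s_ne_t := (Fin.last_pos).ne })
    (X + 2 + (X + 2) * (X + 2) * (2 * (X + 2) + C p * (X + 2 + (X + 2) * (X + 2) + 1))) ?_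
    (fun n a => (a.2 : ℕ) - a.1)
    (fun n l => (l.1.zip l.1.tail).toFinset) ?_ ?_ ?_ (fun n => n + 1) ?_ ?_
    (fun n B => ⟨pathThrough B, (pairwise_pathThrough B).imp fun h => h.ne,
      (pairwise_pathThrough B).isChain.imp fun u v h =>
        Finset.mem_filter.2 ⟨Finset.mem_univ _, h⟩, rfl, getLast?_pathThrough B⟩) ?_ ?_
  · intro n
    have := add_sum_enc_le (p := p) (n + 2)
      (Finset.univ.filter fun a : Fin (n + 2) × Fin (n + 2) => a.1 < a.2)
      (fun a => (a.2 : ℕ) - a.1) (τ := n + 2) (fun a _ => by have := a.2.2; omega)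
    simp only [Fintype.card_prod, Fintype.card_fin] at this
    simp only [eval_add, eval_X, eval_mul, eval_C, eval_ofNat, eval_one]
    exact this
  · intro n l i
    rw [List.sum_toFinset _ l.2.1.zip_tail]
    rfl
  · intro n l a ha
    exact Nat.sub_pos_of_lt
      (List.mem_zip_tail_of_isChain (isChain l.2.2.1) (List.mem_toFinset.1 ha))
  · intro n l
    have : _ + 0 = n + 1 :=
      List.sum_toFinset_zip_tail_sub l.2.1 (isChain l.2.2.1) l.2.2.2.1 l.2.2.2.2
    by_contra h
    rw [Finset.not_nonempty_iff_eq_empty.1 h] at this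
    simp at this
  · intro n l
    exact (List.sum_toFinset_zip_tail_sub l.2.1 (isChain l.2.2.1) l.2.2.2.1 l.2.2.2.2).ge
  · intro n
    simp
  · intro n A B h
    have h' := congrArg (Finset.image Prod.snd) h
    simp only [Function.comp, List.image_snd_zip_tail] at h'
    ext v
    rw [← mem_tail_pathThrough, ← mem_tail_pathThrough, ← List.mem_toFinset, h',
      List.mem_toFinset]
  · intro n B
    exact List.sum_toFinset_zip_tail_sub ((pairwise_pathThrough B).imp fun h => h.ne)
      (pairwise_pathThrough B).isChain rfl (getLast?_pathThrough B)

/-! ### Traveling salesman: undirected tours -/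

/-- The edges of the tour `σ`. -/
def Equiv.Perm.tourEdges {N : ℕ} (σ : Equiv.Perm (Fin N)) : Finset (Sym2 (Fin N)) :=
  Finset.univ.image fun v => s(v, σ v)

section tour

variable {N : ℕ} {σ : Equiv.Perm (Fin N)}

/-- If the square of a cycle fixes a moved point, it is the identity; but the order here is `N ≥ 3`.
-/
theorem Equiv.Perm.IsCycle.apply_apply_ne (hN : 3 ≤ N) (hσ : σ.IsCycle)
    (hs : σ.support = Finset.univ) (v : Fin N) : σ (σ v) ≠ v := by
  intro h
  have h2 : σ ^ 2 = 1 := hσ.pow_eq_one_iff.2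
    ⟨v, Equiv.Perm.mem_support.1 (hs ▸ Finset.mem_univ v), by simpa [sq] using h⟩
  have := Nat.le_of_dvd two_pos (orderOf_dvd_of_pow_eq_one h2)
  rw [hσ.orderOf, hs, Finset.card_univ, Fintype.card_fin] at this
  omega

/-- An edge used twice would be traversed in both directions, making `σ (σ v) = v`. Hence tour
lengths are sums over edge sets. -/
theorem Equiv.Perm.IsCycle.tourEdge_injective (hN : 3 ≤ N) (hσ : σ.IsCycle)
    (hs : σ.support = Finset.univ) : Function.Injective fun v => s(v, σ v) := by
  intro v w h
  rcases Sym2.eq_iff.1 h with h | h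
  · exact h.1
  · exact (hσ.apply_apply_ne hN hs v (by rw [h.2, ← h.1])).elim

theorem Equiv.Perm.IsCycle.sum_tourEdges {M : Type*} [AddCommMonoid M] (hN : 3 ≤ N)
    (hσ : σ.IsCycle) (hs : σ.support = Finset.univ) (f : Sym2 (Fin N) → M) :
    ∑ e ∈ σ.tourEdges, f e = ∑ v, f s(v, σ v) :=
  Finset.sum_image (hσ.tourEdge_injective hN hs).injOn

/-- A tour through the cities `τ v` in the order in which `c` visits the cities `v` is determined by its
edges and the images of two consecutive cities. -/
theorem Equiv.Perm.eq_of_tourEdges_conj_eq {c τ τ' : Equiv.Perm (Fin N)} (hN : 3 ≤ N)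
    (hc : c.IsCycle) (hs : c.support = Finset.univ) {v₀ : Fin N} (h₀ : τ v₀ = τ' v₀)
    (h₁ : τ (c v₀) = τ' (c v₀))
    (h : (τ * c * τ⁻¹).tourEdges = (τ' * c * τ'⁻¹).tourEdges) : τ = τ' := by
  -- In the second tour the city `τ' (c w)` has only the neighbours `τ' w` and `τ' (c (c w))`. The
  -- first equals `τ w`, which is not `τ (c (c w))`, so the second must be the next city.
  have step : ∀ w, τ w = τ' w → τ (c w) = τ' (c w) → τ (c (c w)) = τ' (c (c w)) := by
    intro w hw hcw
    have hmem : s(τ (c w), τ (c (c w))) ∈ (τ' * c * τ'⁻¹).tourEdges :=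
      h ▸ Finset.mem_image.2 ⟨τ (c w), Finset.mem_univ _, by simp⟩
    obtain ⟨v, -, hv⟩ := Finset.mem_image.1 hmem
    obtain ⟨u, rfl⟩ := τ'.surjective v
    have hu : (τ' * c * τ'⁻¹) (τ' u) = τ' (c u) := by simp
    rw [hu] at hv
    rcases Sym2.eq_iff.1 hv with ⟨e₁, e₂⟩ | ⟨e₁, e₂⟩
    · rw [hcw] at e₁
      rw [← e₂, τ'.injective e₁]
    · rw [hcw] at e₂
      rw [c.injective (τ'.injective e₂), ← hw] at e₁
      exact (hc.apply_apply_ne hN hs w (τ.injective e₁).symm).elim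
  have all : ∀ m : ℕ, τ ((c ^ m) v₀) = τ' ((c ^ m) v₀) ∧
      τ (c ((c ^ m) v₀)) = τ' (c ((c ^ m) v₀)) := by
    intro m
    induction m with
    | zero => exact ⟨h₀, h₁⟩
    | succ m ih =>
      rw [pow_succ', Equiv.Perm.mul_apply]
      exact ⟨ih.2, step _ ih.1 ih.2⟩
  have moved : ∀ v, c v ≠ v := fun v => Equiv.Perm.mem_support.1 (hs ▸ Finset.mem_univ v)
  ext v
  obtain ⟨m, rfl⟩ := hc.exists_pow_eq (moved v₀) (moved v)
  rw [(all m).1]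

end tour

/-- The permutation that fixes `0` and `1` and acts on the other elements as `τ`. -/
def fixTwo {n : ℕ} (τ : Equiv.Perm (Fin n)) : Equiv.Perm (Fin (n + 2)) :=
  Equiv.Perm.decomposeFin.symm (0, Equiv.Perm.decomposeFin.symm (0, τ))

theorem fixTwo_injective {n : ℕ} : Function.Injective (fixTwo (n := n)) := by
  intro σ τ h
  simpa [fixTwo] using h

theorem fixTwo_apply_zero {n : ℕ} (τ : Equiv.Perm (Fin n)) : fixTwo τ 0 = 0 := by
  simp [fixTwo]

theorem fixTwo_apply_one {n : ℕ} (τ : Equiv.Perm (Fin n)) : fixTwo τ 1 = 1 := by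
  rw [← Fin.succ_zero_eq_one, fixTwo, Equiv.Perm.decomposeFin_symm_apply_succ]
  simp

open Polynomial in
theorem travelingSalesman_hasIntractableInstances (p : ℕ) :
    (travelingSalesman p).HasIntractableInstances := by
  refine MOProblem.HasIntractableInstances.of_splitCost (Pb := travelingSalesman p)
    (E := fun n => Sym2 (Fin (n + 3))) (ι := fun n => Equiv.Perm (Fin (n + 1)))
    (fun n =>
      { n := n + 3
        three_le := Nat.le_add_left _ _
        dist := fun e => splitCost p 1 e
        dist_pos := fun e _ i => splitCost_pos one_pos _ i })
    (X + 3 + (X + 4) * (X + 4) * (C p * (1 + (X + 4) * (X + 4) + 1))) ?_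
    (fun _ _ => 1) (fun n σ => σ.1.tourEdges) ?_ (fun _ _ _ _ => one_pos)
    (fun n σ => Finset.image_nonempty.2 ⟨(0 : Fin (n + 3)), Finset.mem_univ _⟩)
    (fun n => n + 3) ?_ ?_
    -- The tour visits `0`, `1` and then the other cities in the order given by `τ`; fixing two
    -- consecutive cities rules out rotations and reversal.
    (fun n τ => ⟨fixTwo τ * finRotate (n + 3) * (fixTwo τ)⁻¹, isCycle_finRotate.conj, ?_⟩) ?_ ?_
  · intro n
    have hcard : Fintype.card (Sym2 (Fin (n + 3))) ≤ (n + 4) * (n + 4) := by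
      rw [Sym2.card, Fintype.card_fin]
      exact (Nat.choose_le_pow _ _).trans_eq (sq _)
    simp only [eval_add, eval_X, eval_mul, eval_C, eval_ofNat, eval_one]
    refine Nat.add_le_add_left ?_ _
    refine (Finset.sum_le_card_nsmul _ _ _ fun e _ => vecEnc_splitCost_le 1 e).trans ?_
    refine Nat.mul_le_mul ((Finset.card_le_univ _).trans hcard) ?_
    gcongr
  · exact fun n σ i =>
      (σ.2.1.sum_tourEdges (Nat.le_add_left 3 n) σ.2.2 fun e => splitCost p 1 e i).symm
  · exact fun n σ => ((σ.2.1.sum_tourEdges (Nat.le_add_left 3 n) σ.2.2 fun _ => 1).trans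
      (by simp)).ge
  · intro n
    rw [Fintype.card_perm, Fintype.card_fin]
    exact two_pow_le_factorial_succ n
  · rw [Equiv.Perm.support_conj, support_finRotate]
    exact Finset.map_univ_equiv _
  · intro n σ τ h
    refine fixTwo_injective (Equiv.Perm.eq_of_tourEdges_conj_eq (v₀ := 0) (Nat.le_add_left 3 n)
      isCycle_finRotate support_finRotate ?_ ?_ h)
    · rw [fixTwo_apply_zero, fixTwo_apply_zero]
    · rw [finRotate_apply_zero, fixTwo_apply_one, fixTwo_apply_one]
  · exact fun n τ => (Equiv.Perm.IsCycle.sum_tourEdges (Nat.le_add_left 3 n)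
      isCycle_finRotate.conj (by rw [Equiv.Perm.support_conj, support_finRotate]; simp)
      fun _ => 1).trans (by simp)

theorem theorem4 (p : ℕ) :
    ∀ Pb ∈ ({shortestPath p, minSpanningTree p, assignment p, minSTCut p, knapsack p,
        travelingSalesman p} : Set (MOProblem p)),
      ∃ I : ℕ → Pb.Instance,
        (∀ n x i, 0 < Pb.objective (I n) x i) ∧
        ∀ Q : Polynomial ℕ, ∀ᶠ n in Filter.atTop,
          ∀ k : ℕ, ⌈(p : ℝ) / 2⌉₊ < k → ∀ ε : ℝ, 0 < ε →
            ∀ P : Set (Pb.Solution (I n)),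
              Pb.IsQuasiExactApproximationSet (I n) k ε P →
                ((Q.eval (Pb.encLen (I n)) : ℕ) : ℕ∞) < P.encard := by
  rintro Pb (rfl | rfl | rfl | rfl | rfl | rfl)
  · exact shortestPath_hasIntractableInstances p
  · exact minSpanningTree_hasIntractableInstances p
  · exact assignment_hasIntractableInstances p
  · exact minSTCut_hasIntractableInstances p
  · exact knapsack_hasIntractableInstances p
  · exact travelingSalesman_hasIntractableInstances p
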